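/- **Theorem 3.** *Setting.* There are $M$ traffic flows and slots $t\in\{0,1,2,\dots\}$. On slot $t$, $A_m(t)\in\{0,1\}$ packets of flow $m$ arrive; the vectors $A(t)=(A_1(t),\dots,A_M(t))$ are i.i.d. over slots with mean $\lambda=(\lambda_1,\dots,\lambda_M)$. There is a finite set $\mathcal A$ of coding actions; each $\alpha\in\mathcal A$ has a frame size $T(\alpha)\in\{1,2,\dots\}$ and a clearance vector $\mu(\alpha)\in\{0,1,2,\dots\}^M$. Time is divided into consecutive frames of variable length: frame $0$ starts at $t[0]=0$, an action $\alpha[r]\in\mathcal A$ is used on frame $r$, and $t[r+1]=t[r]+T(\alpha[r])$. The backlogs $Q_m[r]$ at the starts of the frames begin with an arbitrary (possibly random) $Q[0]\in\{0,1,2,\dots\}^M$ and satisfy $$Q_m[r+1]=\max\big[Q_m[r]-\mu_m(\alpha[r]),\,0\big]+\sum_{\tau=t[r]}^{t[r]+T(\alpha[r])-1}A_m(\tau).$$ Queue $m$ is *rate stable* if $\lim_{R\to\infty}Q_m[R]/R=0$ with probability $1$. The *code-constrained capacity region* $\Lambda_{\mathcal A}$ is the set of all rate vectors $\lambda$ for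 which there is a (possibly randomized) way of selecting the actions $\alpha[r]\in\mathcal A$ over frames that makes all queues rate stable. *Statement.* Suppose that $\lambda\in\Lambda_{\mathcal A}$. Then all queues $Q_1,\dots,Q_M$ are rate stable under either of the following two algorithms, in both of which ties are broken arbitrarily. 1. (Algorithm 1, known $\lambda$) On every frame $r$, $\alpha[r]$ is chosen as a maximizer over $\alpha\in\mathcal A$ of $\sum_{m=1}^M Q_m[r]\,\big[\mu_m(\alpha)-\lambda_m T(\alpha)\big]$. 2. (Algorithm 2, unknown $\lambda$) On every frame $r$, $\alpha[r]$ is chosen as a maximizer over $\alpha\in\mathcal A$ of $\sum_{m=1}^M Q_m[r]\,\frac{\mu_m(\alpha)}{T(\alpha)}$. -/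

import Mathlib

open MeasureTheory ProbabilityTheory Filter Topology

namespace DynamicIndexCoding

universe u v

/-- The data attached to the coding actions `a ∈ 𝒜` in a system with `M` traffic flows. -/
structure ActionData (M : ℕ) (𝒜 : Type v) where
  /-- Frame size `T(a)`: the number of slots needed to carry out `a`. -/
  frameSize : 𝒜 → ℕ
  frameSize_pos : ∀ a, 0 < frameSize a
  /-- Clearance vector `μ(a)`: the number of packets of each flow delivered by `a`. -/
  clearance : 𝒜 → Fin M → ℕ

variable {M : ℕ} {𝒜 : Type v}

/-- The slot `t[r]` at which frame `r` starts, when action `a r` is used on frame `r`. -/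
def frameStart (D : ActionData M 𝒜) (a : ℕ → 𝒜) : ℕ → ℕ
  | 0 => 0
  | r + 1 => frameStart D a r + D.frameSize (a r)

/-- The number of packets of flow `m` that arrive during frame `r`, i.e. during the slots
`t[r], …, t[r] + T(a r) - 1`, where `x t m` packets of flow `m` arrive on slot `t`. -/
def frameArrivals (D : ActionData M 𝒜) (a : ℕ → 𝒜) (x : ℕ → Fin M → ℕ) (r : ℕ) (m : Fin M) : ℕ :=
  ∑ t ∈ Finset.Ico (frameStart D a r) (frameStart D a r + D.frameSize (a r)), x t m

/-- The queue backlog `Q_m[r]` at the start of frame `r`, from the initial backlog `q`: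
`Q_m[r+1] = max (Q_m[r] - μ_m(a r)) 0 + arrivals_m[r]`.
Subtraction of natural numbers is truncated at `0`, which is the maximum with `0`. -/
def queue (D : ActionData M 𝒜) (a : ℕ → 𝒜) (x : ℕ → Fin M → ℕ) (q : Fin M → ℕ) :
    ℕ → Fin M → ℕ
  | 0, m => q m
  | r + 1, m => (queue D a x q r m - D.clearance (a r) m) + frameArrivals D a x r m

/-- The vectors `A t` (`t` a slot) are i.i.d. with entries in `{0, 1}` and mean `rate`. -/
structure IsArrivalProcess {Ω : Type u} [MeasurableSpace Ω] (P : Measure Ω)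
    (A : ℕ → Ω → Fin M → ℕ) (rate : Fin M → ℝ) : Prop where
  measurable : ∀ t, Measurable (A t)
  indep : iIndepFun A P
  identDistrib : ∀ t, IdentDistrib (A t) (A 0) P P
  binary : ∀ t ω m, A t ω m = 0 ∨ A t ω m = 1
  mean : ∀ t m, ∫ ω, (A t ω m : ℝ) ∂P = rate m

/-- All queues are rate stable: for each flow `m`, `Q_m[R] / R → 0` with probability 1.
Here `α r ω` is the action of frame `r`, `A t ω` is the arrival vector of slot `t`, and `q ω` is
the initial backlog vector. -/
def AllRateStable (D : ActionData M 𝒜) {Ω : Type u} [MeasurableSpace Ω] (P : Measure Ω)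
    (A : ℕ → Ω → Fin M → ℕ) (q : Ω → Fin M → ℕ) (α : ℕ → Ω → 𝒜) : Prop :=
  ∀ m, ∀ᵐ ω ∂P, Tendsto
    (fun R : ℕ => (queue D (fun r => α r ω) (fun t => A t ω) (q ω) R m : ℝ) / (R : ℝ))
    atTop (𝓝 0)

/-- The code-constrained capacity region `Λ_𝒜`: the rate vectors for which some (possibly
randomized) selection of actions over the frames makes all queues rate stable.
The selection may be any process of actions on a probability space that carries the arrivals. -/
def capacityRegion (D : ActionData M 𝒜) : Set (Fin M → ℝ) :=
  {rate | ∃ (Ω : Type u) (_ : MeasurableSpace Ω) (P : Measure Ω) (A : ℕ → Ω → Fin M → ℕ)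
    (q : Ω → Fin M → ℕ) (α : ℕ → Ω → 𝒜),
    IsProbabilityMeasure P ∧ IsArrivalProcess P A rate ∧ AllRateStable D P A q α}

/-- The quantity maximized by the rule that knows the rates:
`∑ m, Q_m (μ_m(a) - λ_m T(a))`. -/
noncomputable def weightKnown (D : ActionData M 𝒜) (rate : Fin M → ℝ) (Q : Fin M → ℕ) (a : 𝒜) : ℝ :=
  ∑ m, (Q m : ℝ) * ((D.clearance a m : ℝ) - rate m * (D.frameSize a : ℝ))

/-- The quantity maximized by the rule that does not know the rates:
`∑ m, Q_m (μ_m(a) / T(a))`. -/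
noncomputable def weightRatio (D : ActionData M 𝒜) (Q : Fin M → ℕ) (a : 𝒜) : ℝ :=
  ∑ m, (Q m : ℝ) * ((D.clearance a m : ℝ) / (D.frameSize a : ℝ))

/-- The action sequence `a` is one that the max-weight rule with weight `W` can produce on the
arrivals `x` from the initial backlog `q`: on every frame `r` the action `a r` maximizes
`W Q[r]` over all actions, `Q[r]` being the backlog that results from the earlier actions.
Ties are broken arbitrarily. -/
def FollowsMaxWeight (D : ActionData M 𝒜) (W : (Fin M → ℕ) → 𝒜 → ℝ)
    (a : ℕ → 𝒜) (x : ℕ → Fin M → ℕ) (q : Fin M → ℕ) : Prop :=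
  ∀ r, ∀ b : 𝒜, W (queue D a x q r) b ≤ W (queue D a x q r) (a r)

end DynamicIndexCoding

namespace DynamicIndexCoding

open Asymptotics

universe w

variable {M : ℕ} {𝒜 : Type w}

/-! The argument is pathwise. By the strong law, almost surely the excess of arrivals over their
mean is o(n); the rest is deterministic. If every action had negative weight against some fixed Q,
finiteness of `𝒜` would make the gap uniform, and the Q-weighted backlog would grow linearly under
any selection. One stable path thus yields, for every Q, an action of nonnegative weight
(`exists_weightKnown_nonneg`). Both rules then pick such an action: the known-rate weight is `T(b)`
times the ratio weight shifted by a constant independent of `b`. Conversely, nonnegative weights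
force sublinear backlogs (`queue_isLittleO`). With e the excess at frame starts, the Lyapunov
function ∑ (Q - e)² sees mean arrivals only, so its drift is O(1 + |e|) = o(R). It is therefore
o(R²), and Q = o(R). -/

/-- The excess of the arrivals of flow `m` during the first `n` slots over their mean. -/
noncomputable def arrivalExcess (x : ℕ → Fin M → ℕ) (rate : Fin M → ℝ) (m : Fin M) (n : ℕ) : ℝ :=
  ∑ t ∈ Finset.range n, (x t m : ℝ) - rate m * n

lemma frameStart_eq_sum (D : ActionData M 𝒜) (a : ℕ → 𝒜) (R : ℕ) :
    frameStart D a R = ∑ r ∈ Finset.range R, D.frameSize (a r) := by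
  induction R with
  | zero => simp [frameStart]
  | succ R ih => rw [Finset.sum_range_succ, frameStart, ih]

lemma le_frameStart (D : ActionData M 𝒜) (a : ℕ → 𝒜) (R : ℕ) : R ≤ frameStart D a R := by
  rw [frameStart_eq_sum]
  simpa using Finset.card_nsmul_le_sum (Finset.range R) (fun r => D.frameSize (a r)) 1
    (fun r _ => D.frameSize_pos (a r))

lemma frameStart_le (D : ActionData M 𝒜) {B : ℕ} (hB : ∀ b, D.frameSize b ≤ B) (a : ℕ → 𝒜)
    (R : ℕ) : frameStart D a R ≤ R * B := by
  rw [frameStart_eq_sum]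
  simpa using Finset.sum_le_card_nsmul (Finset.range R) (fun r => D.frameSize (a r)) B
    (fun r _ => hB (a r))

lemma sum_range_frameStart_succ (D : ActionData M 𝒜) (a : ℕ → 𝒜) (x : ℕ → Fin M → ℕ) (r : ℕ)
    (m : Fin M) :
    ∑ t ∈ Finset.range (frameStart D a (r + 1)), x t m =
      ∑ t ∈ Finset.range (frameStart D a r), x t m + frameArrivals D a x r m := by
  rw [frameArrivals, frameStart]
  exact (Finset.sum_range_add_sum_Ico _ (Nat.le_add_right _ _)).symm

lemma arrivalExcess_frameStart_succ (D : ActionData M 𝒜) (a : ℕ → 𝒜) (x : ℕ → Fin M → ℕ)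
    (rate : Fin M → ℝ) (r : ℕ) (m : Fin M) :
    arrivalExcess x rate m (frameStart D a (r + 1)) =
      arrivalExcess x rate m (frameStart D a r) + frameArrivals D a x r m
        - rate m * D.frameSize (a r) := by
  have h : (∑ t ∈ Finset.range (frameStart D a (r + 1)), (x t m : ℝ)) =
      ∑ t ∈ Finset.range (frameStart D a r), (x t m : ℝ) + frameArrivals D a x r m := by
    exact_mod_cast sum_range_frameStart_succ D a x r m
  rw [arrivalExcess, arrivalExcess, h, frameStart]
  push_cast
  ring

/-- Every packet that has arrived is still queued or has been cleared. -/
lemma arrivals_le_queue_add_clearance (D : ActionData M 𝒜) (a : ℕ → 𝒜) (x : ℕ → Fin M → ℕ)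
    (q : Fin M → ℕ) (R : ℕ) (m : Fin M) :
    ∑ t ∈ Finset.range (frameStart D a R), x t m ≤
      queue D a x q R m + ∑ r ∈ Finset.range R, D.clearance (a r) m := by
  induction R with
  | zero => simp [frameStart]
  | succ R ih =>
    rw [sum_range_frameStart_succ, Finset.sum_range_succ, queue]
    omega

/-- Frame time and slot time are comparable: R ≤ t[R] ≤ B R, with B the largest frame size. -/
lemma isLittleO_comp_frameStart [Finite 𝒜] (D : ActionData M 𝒜) (a : ℕ → 𝒜) {e : ℕ → ℝ}
    (he : e =o[atTop] fun n : ℕ => (n : ℝ)) :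
    (fun R => e (frameStart D a R)) =o[atTop] fun R : ℕ => (R : ℝ) := by
  obtain ⟨B, hB⟩ := (Set.finite_range D.frameSize).bddAbove
  refine (he.comp_tendsto (tendsto_atTop_mono (le_frameStart D a) tendsto_id)).trans_isBigO ?_
  refine IsBigO.of_bound (B : ℝ) (Eventually.of_forall fun R => ?_)
  have h := frameStart_le D (fun b => hB ⟨b, rfl⟩) a R
  simp only [Function.comp, Real.norm_natCast]
  rw [mul_comm]
  exact_mod_cast h

/-- If some selection of actions keeps the backlogs sublinear, then for every backlog vector
some action has nonnegative drift weight. -/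
lemma exists_weightKnown_nonneg [Finite 𝒜] (D : ActionData M 𝒜) (rate : Fin M → ℝ)
    (a : ℕ → 𝒜) (x : ℕ → Fin M → ℕ) (q : Fin M → ℕ)
    (hx : ∀ m, arrivalExcess x rate m =o[atTop] fun n : ℕ => (n : ℝ))
    (hq : ∀ m, (fun R => (queue D a x q R m : ℝ)) =o[atTop] fun R : ℕ => (R : ℝ))
    (Q : Fin M → ℕ) : ∃ b, 0 ≤ weightKnown D rate Q b := by
  by_contra! hneg
  have : Nonempty 𝒜 := ⟨a 0⟩
  obtain ⟨b₀, hb₀⟩ := Finite.exists_max (weightKnown D rate Q)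
  -- Every frame loses at least δ in weight, since the maximal weight is -δ.
  set δ := -weightKnown D rate Q b₀ with hδ
  have hδpos : 0 < δ := by linarith [hneg b₀]
  have hlower : ∀ R : ℕ, δ * R ≤
      ∑ m, (Q m : ℝ) * (queue D a x q R m - arrivalExcess x rate m (frameStart D a R)) := by
    intro R
    have h1 : ∑ r ∈ Finset.range R, weightKnown D rate Q (a r) ≤ -(δ * R) := by
      calc ∑ r ∈ Finset.range R, weightKnown D rate Q (a r)
          ≤ ∑ r ∈ Finset.range R, -δ :=
            Finset.sum_le_sum fun r _ => by linarith [hb₀ (a r)]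
        _ = -(δ * R) := by simp; ring
    have h2 : ∑ r ∈ Finset.range R, weightKnown D rate Q (a r) =
        ∑ m, (Q m : ℝ) * (∑ r ∈ Finset.range R, (D.clearance (a r) m : ℝ)
          - rate m * frameStart D a R) := by
      simp only [weightKnown]
      rw [Finset.sum_comm]
      refine Finset.sum_congr rfl fun m _ => ?_
      rw [← Finset.mul_sum, Finset.sum_sub_distrib, ← Finset.mul_sum, frameStart_eq_sum]
      push_cast
      rfl
    have h3 : ∑ m, (Q m : ℝ) * (arrivalExcess x rate m (frameStart D a R) - queue D a x q R m) ≤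
        ∑ m, (Q m : ℝ) * (∑ r ∈ Finset.range R, (D.clearance (a r) m : ℝ)
          - rate m * frameStart D a R) := by
      refine Finset.sum_le_sum fun m _ => mul_le_mul_of_nonneg_left ?_ (Nat.cast_nonneg _)
      have h : (∑ t ∈ Finset.range (frameStart D a R), (x t m : ℝ)) ≤
          queue D a x q R m + ∑ r ∈ Finset.range R, (D.clearance (a r) m : ℝ) := by
        exact_mod_cast arrivals_le_queue_add_clearance D a x q R m
      rw [arrivalExcess]
      linarith
    have h4 : ∑ m, (Q m : ℝ) * (queue D a x q R m - arrivalExcess x rate m (frameStart D a R)) =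
        -∑ m, (Q m : ℝ) *
          (arrivalExcess x rate m (frameStart D a R) - queue D a x q R m) := by
      rw [← Finset.sum_neg_distrib]
      exact Finset.sum_congr rfl fun m _ => by ring
    linarith
  have hlittle : (fun R : ℕ => ∑ m, (Q m : ℝ) *
      (queue D a x q R m - arrivalExcess x rate m (frameStart D a R))) =o[atTop]
        fun R : ℕ => (R : ℝ) :=
    IsLittleO.fun_sum fun m _ =>
      ((hq m).sub (isLittleO_comp_frameStart D a (hx m))).const_mul_left _
  -- At such an R > 0 the sum is at most δR/2, against the lower bound δR.
  obtain ⟨R, hR, hRpos⟩ :=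
    ((hlittle.bound (half_pos hδpos)).and (eventually_gt_atTop 0)).exists
  have hRpos' : (0 : ℝ) < R := by exact_mod_cast hRpos
  have h := (hlower R).trans ((le_abs_self _).trans hR)
  rw [Real.norm_natCast] at h
  nlinarith

/-- One-frame drift of the squared backlog, after the arrival fluctuation `e` is subtracted. -/
lemma sq_drift_le {Q μ y : ℕ} {s e e' B C : ℝ} (he : e' = e + y - s) (hμ : (μ : ℝ) ≤ B)
    (hs : |s| + B ≤ C) :
    (((Q - μ + y : ℕ) : ℝ) - e') ^ 2 ≤
      ((Q : ℝ) - e) ^ 2 - 2 * (Q * (μ - s)) + (2 * B ^ 2 + C ^ 2 + 2 * C * |e|) := by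
  -- The unused service i vanishes unless Q < μ, which keeps Q * i bounded even for large Q.
  obtain ⟨i, hi⟩ : ∃ i : ℝ, i = ((Q - μ : ℕ) : ℝ) - (Q - μ) := ⟨_, rfl⟩
  have hμ0 : (0 : ℝ) ≤ μ := Nat.cast_nonneg _
  have key : 0 ≤ i ∧ i ≤ μ ∧ Q * i ≤ B ^ 2 := by
    rcases le_total μ Q with h | h
    · rw [Nat.cast_sub h, sub_self] at hi
      subst hi
      exact ⟨le_rfl, hμ0, by simpa using sq_nonneg B⟩
    · rw [Nat.sub_eq_zero_of_le h] at hi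
      have h' : (Q : ℝ) ≤ μ := by exact_mod_cast h
      have hQ0 : (0 : ℝ) ≤ Q := Nat.cast_nonneg _
      push_cast at hi
      refine ⟨by linarith, by linarith, ?_⟩
      nlinarith
  obtain ⟨hi0, hiμ, hQi⟩ := key
  have hd : |s - μ + i| ≤ C := by
    have := neg_abs_le s
    have := le_abs_self s
    rw [abs_le]
    constructor <;> linarith
  have hC : 0 ≤ C := (abs_nonneg _).trans hd
  have hd2 : (s - μ + i) ^ 2 ≤ C ^ 2 := sq_le_sq' (abs_le.1 hd).1 (abs_le.1 hd).2
  have hed : -(e * (s - μ + i)) ≤ C * |e| :=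
    calc -(e * (s - μ + i)) ≤ |e * (s - μ + i)| := neg_le_abs _
      _ = |s - μ + i| * |e| := by rw [abs_mul, mul_comm]
      _ ≤ C * |e| := mul_le_mul_of_nonneg_right hd (abs_nonneg _)
  have hZ : ((Q - μ + y : ℕ) : ℝ) - e' = (Q - e) + (s - μ + i) := by
    rw [he, hi]
    push_cast
    ring
  rw [hZ]
  -- In the expanded square, 2B² pays for 2Qi, C² for the squared increment, and 2C|e| for the cross
  -- term with e.
  nlinarith

/-- If every frame uses an action of nonnegative drift weight, the backlogs are sublinear. -/
lemma queue_isLittleO [Finite 𝒜] (D : ActionData M 𝒜) (rate : Fin M → ℝ)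
    (a : ℕ → 𝒜) (x : ℕ → Fin M → ℕ) (q : Fin M → ℕ)
    (hx : ∀ m, arrivalExcess x rate m =o[atTop] fun n : ℕ => (n : ℝ))
    (ha : ∀ r, 0 ≤ weightKnown D rate (queue D a x q r) (a r)) (m : Fin M) :
    (fun R => (queue D a x q R m : ℝ)) =o[atTop] fun R : ℕ => (R : ℝ) := by
  obtain ⟨B, hB⟩ := (Set.finite_range fun p : 𝒜 × Fin M => (D.clearance p.1 p.2 : ℝ)).bddAbove
  obtain ⟨S, hS⟩ :=
    (Set.finite_range fun p : 𝒜 × Fin M => |rate p.2 * D.frameSize p.1|).bddAbove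
  set C := S + B
  set e : Fin M → ℕ → ℝ := fun m R => arrivalExcess x rate m (frameStart D a R) with he
  have heo : ∀ m, e m =o[atTop] fun R : ℕ => (R : ℝ) := fun m =>
    isLittleO_comp_frameStart D a (hx m)
  set V : ℕ → ℝ := fun R => ∑ m, ((queue D a x q R m : ℝ) - e m R) ^ 2 with hV
  set g : ℕ → ℝ := fun R => ∑ m, (2 * B ^ 2 + C ^ 2 + 2 * C * |e m R|) with hg
  have hstep : ∀ R, V (R + 1) ≤ V R + g R := by
    intro R
    have h : V (R + 1) ≤ V R - 2 * weightKnown D rate (queue D a x q R) (a R) + g R := by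
      simp only [hV, hg, weightKnown, Finset.mul_sum]
      rw [← Finset.sum_sub_distrib, ← Finset.sum_add_distrib]
      refine Finset.sum_le_sum fun m _ => ?_
      exact sq_drift_le (arrivalExcess_frameStart_succ D a x rate R m) (hB ⟨(a R, m), rfl⟩)
        (by linarith [hS ⟨(a R, m), rfl⟩])
    linarith [ha R]
  have hsum : ∀ R, V R ≤ V 0 + ∑ r ∈ Finset.range R, g r := by
    intro R
    induction R with
    | zero => simp
    | succ R ih => rw [Finset.sum_range_succ]; linarith [hstep R]
  have hconst : ∀ c : ℝ, (fun _ : ℕ => c) =o[atTop] fun R : ℕ => (R : ℝ) := fun c =>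
    isLittleO_const_left.2 (Or.inr (tendsto_norm_atTop_atTop.comp (tendsto_natCast_atTop_atTop (R := ℝ))))
  have hgo : g =o[atTop] fun R : ℕ => (R : ℝ) :=
    IsLittleO.fun_sum fun m _ => (hconst _).add ((heo m).abs_left.const_mul_left _)
  have hquad : (fun R : ℕ => ∑ r ∈ Finset.range R, (r : ℝ)) =O[atTop]
      fun R : ℕ => (R : ℝ) ^ 2 := by
    refine IsBigO.of_bound 1 (Eventually.of_forall fun R => ?_)
    rw [one_mul, Real.norm_of_nonneg (Finset.sum_nonneg fun r _ => Nat.cast_nonneg _),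
      Real.norm_of_nonneg (by positivity)]
    calc ∑ r ∈ Finset.range R, (r : ℝ) ≤ ∑ r ∈ Finset.range R, (R : ℝ) :=
          Finset.sum_le_sum fun r hr => by exact_mod_cast (Finset.mem_range.1 hr).le
      _ = (R : ℝ) ^ 2 := by simp [sq]
  -- Divergence of ∑ r lets g = o(r) be summed; the last term R - 1 already diverges.
  have hdiv : Tendsto (fun R : ℕ => ∑ r ∈ Finset.range R, (r : ℝ)) atTop atTop := by
    refine tendsto_atTop_mono' _ ?_
      ((tendsto_natCast_atTop_atTop (R := ℝ)).comp (tendsto_sub_atTop_nat 1))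
    filter_upwards [eventually_ge_atTop 1] with R hR
    exact Finset.single_le_sum (f := fun r : ℕ => (r : ℝ)) (fun r _ => Nat.cast_nonneg r)
      (Finset.mem_range.2 (Nat.sub_lt hR one_pos))
  have hGo : (fun R : ℕ => ∑ r ∈ Finset.range R, g r) =o[atTop] fun R : ℕ => (R : ℝ) ^ 2 :=
    (hgo.sum_range (fun r => Nat.cast_nonneg r) hdiv).trans_isBigO hquad
  have hV0 : (fun _ : ℕ => V 0) =o[atTop] fun R : ℕ => (R : ℝ) ^ 2 := by
    refine isLittleO_const_left.2 (Or.inr ?_)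
    refine tendsto_norm_atTop_atTop.comp ?_
    exact (tendsto_pow_atTop two_ne_zero).comp tendsto_natCast_atTop_atTop
  have hZ2 : (fun R : ℕ => ((queue D a x q R m : ℝ) - e m R) ^ 2) =o[atTop]
      fun R : ℕ => (R : ℝ) ^ 2 := by
    refine IsBigO.trans_isLittleO (IsBigO.of_bound 1 (Eventually.of_forall fun R => ?_))
      (hV0.add hGo)
    rw [one_mul, Real.norm_of_nonneg (sq_nonneg _)]
    refine le_trans ?_ ((hsum R).trans (le_abs_self _))
    exact Finset.single_le_sum (f := fun m => ((queue D a x q R m : ℝ) - e m R) ^ 2)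
      (fun m _ => sq_nonneg _) (Finset.mem_univ m)
  have hZ : (fun R : ℕ => (queue D a x q R m : ℝ) - e m R) =o[atTop] fun R : ℕ => (R : ℝ) :=
    IsLittleO.of_pow hZ2 two_ne_zero
  simpa using hZ.add (heo m)

lemma natCast_isLittleO_iff {f : ℕ → ℝ} :
    f =o[atTop] (fun n : ℕ => (n : ℝ)) ↔ Tendsto (fun n : ℕ => f n / n) atTop (𝓝 0) := by
  refine isLittleO_iff_tendsto' ?_
  filter_upwards [eventually_gt_atTop 0] with n hn h
  exact absurd h (by exact_mod_cast hn.ne')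

/-- The strong law of large numbers for the arrivals. -/
lemma IsArrivalProcess.ae_arrivalExcess_isLittleO {Ω : Type*} [MeasurableSpace Ω] {P : Measure Ω}
    [IsProbabilityMeasure P] {A : ℕ → Ω → Fin M → ℕ} {rate : Fin M → ℝ}
    (hA : IsArrivalProcess P A rate) :
    ∀ᵐ ω ∂P, ∀ m, arrivalExcess (fun t => A t ω) rate m =o[atTop] fun n : ℕ => (n : ℝ) := by
  rw [ae_all_iff]
  intro m
  have hφ : Measurable fun v : Fin M → ℕ => (v m : ℝ) :=
    measurable_from_top.comp (measurable_pi_apply m)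
  have hint : Integrable (fun ω => (A 0 ω m : ℝ)) P := by
    refine Integrable.of_bound (hφ.comp (hA.measurable 0)).aestronglyMeasurable 1
      (Eventually.of_forall fun ω => ?_)
    rcases hA.binary 0 ω m with h | h <;> simp [h]
  have hslln := strong_law_ae_real (fun t ω => (A t ω m : ℝ)) hint
    (fun i j hij => (hA.indep.indepFun hij).comp hφ hφ)
    (fun t => (hA.identDistrib t).comp hφ)
  filter_upwards [hslln] with ω hω
  rw [natCast_isLittleO_iff]
  have h := hω.sub_const (rate m)
  rw [hA.mean 0 m, sub_self] at h
  refine h.congr' ?_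
  filter_upwards [eventually_gt_atTop 0] with n hn
  have hn' : (n : ℝ) ≠ 0 := by exact_mod_cast hn.ne'
  rw [arrivalExcess]
  field_simp

/-- The strong law and stability both hold almost surely, so a single sample path satisfies both,
and one path suffices for every Q. -/
lemma exists_weightKnown_nonneg_of_mem_capacityRegion [Finite 𝒜] (D : ActionData M 𝒜)
    {rate : Fin M → ℝ} (hrate : rate ∈ capacityRegion D) (Q : Fin M → ℕ) :
    ∃ b, 0 ≤ weightKnown D rate Q b := by
  obtain ⟨Ω, _, P, A, q, α, _, hA, hstable⟩ := hrate
  obtain ⟨ω, hω, hqω⟩ := (hA.ae_arrivalExcess_isLittleO.and (ae_all_iff.2 hstable)).exists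
  exact exists_weightKnown_nonneg D rate (fun r => α r ω) (fun t => A t ω) (q ω) hω
    (fun m => natCast_isLittleO_iff.2 (hqω m)) Q

lemma weightKnown_eq_frameSize_mul (D : ActionData M 𝒜) (rate : Fin M → ℝ) (Q : Fin M → ℕ)
    (b : 𝒜) :
    weightKnown D rate Q b = D.frameSize b * (weightRatio D Q b - ∑ m, (Q m : ℝ) * rate m) := by
  have hT : (D.frameSize b : ℝ) ≠ 0 := by exact_mod_cast (D.frameSize_pos b).ne'
  rw [weightKnown, weightRatio, ← Finset.sum_sub_distrib, Finset.mul_sum]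
  refine Finset.sum_congr rfl fun m _ => ?_
  field_simp

/-- A maximizer of the ratio weight has nonnegative drift weight as soon as some action does. -/
lemma weightKnown_nonneg_of_forall_weightRatio_le (D : ActionData M 𝒜) {rate : Fin M → ℝ}
    {Q : Fin M → ℕ} {b : 𝒜} (hb : ∀ c, weightRatio D Q c ≤ weightRatio D Q b)
    (h : ∃ c, 0 ≤ weightKnown D rate Q c) : 0 ≤ weightKnown D rate Q b := by
  obtain ⟨c, hc⟩ := h
  rw [weightKnown_eq_frameSize_mul] at hc ⊢
  have hT : (0 : ℝ) < D.frameSize c := by exact_mod_cast D.frameSize_pos c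
  have := nonneg_of_mul_nonneg_right hc hT
  exact mul_nonneg (Nat.cast_nonneg _) (by linarith [hb c])

lemma IsArrivalProcess.allRateStable [Finite 𝒜] (D : ActionData M 𝒜) {Ω : Type*}
    [MeasurableSpace Ω] {P : Measure Ω} [IsProbabilityMeasure P] {A : ℕ → Ω → Fin M → ℕ}
    {rate : Fin M → ℝ} (hA : IsArrivalProcess P A rate) (q : Ω → Fin M → ℕ) (α : ℕ → Ω → 𝒜)
    (h : ∀ᵐ ω ∂P, ∀ r, 0 ≤ weightKnown D rate
      (queue D (fun r => α r ω) (fun t => A t ω) (q ω) r) (α r ω)) :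
    AllRateStable D P A q α := by
  intro m
  filter_upwards [hA.ae_arrivalExcess_isLittleO, h] with ω hω hα
  exact natCast_isLittleO_iff.1 (queue_isLittleO D rate _ _ _ hω hα m)

end DynamicIndexCoding

theorem theorem3 {M : ℕ} {𝒜 : Type*} [Finite 𝒜] (D : DynamicIndexCoding.ActionData M 𝒜)
    (rate : Fin M → ℝ) (hrate : rate ∈ DynamicIndexCoding.capacityRegion D)
    {Ω : Type*} [MeasurableSpace Ω] (P : Measure Ω) [IsProbabilityMeasure P]
    (A : ℕ → Ω → Fin M → ℕ) (hA : DynamicIndexCoding.IsArrivalProcess P A rate)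
    (q : Ω → Fin M → ℕ) :
    (∀ α : ℕ → Ω → 𝒜,
      (∀ᵐ ω ∂P, DynamicIndexCoding.FollowsMaxWeight D (DynamicIndexCoding.weightKnown D rate)
        (fun r => α r ω) (fun t => A t ω) (q ω)) →
      DynamicIndexCoding.AllRateStable D P A q α) ∧
    (∀ α : ℕ → Ω → 𝒜,
      (∀ᵐ ω ∂P, DynamicIndexCoding.FollowsMaxWeight D (DynamicIndexCoding.weightRatio D)
        (fun r => α r ω) (fun t => A t ω) (q ω)) →
      DynamicIndexCoding.AllRateStable D P A q α) := by
  have hcap := DynamicIndexCoding.exists_weightKnown_nonneg_of_mem_capacityRegion D hrate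
  refine ⟨fun α hα => hA.allRateStable D q α ?_, fun α hα => hA.allRateStable D q α ?_⟩
  · filter_upwards [hα] with ω hω r
    obtain ⟨b, hb⟩ := hcap _
    exact hb.trans (hω r b)
  · filter_upwards [hα] with ω hω r
    exact DynamicIndexCoding.weightKnown_nonneg_of_forall_weightRatio_le D (hω r) (hcap _)
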